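/- Let $\Omega\subseteq\mathbb R^2$ be open and connected, $(x_0,t_0)\in\Omega$, and let $(q,r)$ be a $C^2$ solution on $\Omega$ of the coupled DNLSII equations $$\mathrm i q_t+q_{xx}+\mathrm i q r q_x=0,\qquad \mathrm i r_t-r_{xx}+\mathrm i r q r_x=0 .$$ Put $$J=\begin{pmatrix}1&0\\0&-1\end{pmatrix},\quad Q=\begin{pmatrix}0&q\\-r&0\end{pmatrix},\quad W=\begin{pmatrix}0&\mathrm i q_x-\frac12q^2r\\ \mathrm i r_x+\frac12r^2q&0\end{pmatrix},$$ $$U=\bigl(-\mathrm i\lambda^2+\tfrac{\mathrm i}4qr\bigr)J+\lambda Q,\qquad V=\bigl(-2\mathrm i\lambda^4+\mathrm i qr\lambda^2+\tfrac14(qr_x-rq_x)-\tfrac{\mathrm i}8q^2r^2\bigr)J+2\lambda^3Q+\lambda W .$$ Let $n\ge1$, let $\lambda_1,\dots,\lambda_n$ be distinct nonzero complex numbers, and let $\Phi_j=(f_j,g_j)^T$ be differentiable solutions on $\Omega$ of $\Phi_x=U\Phi$, $\Phi_t=V\Phi$ at $\lambda=\lambda_j$ $(1\le j\le n)$. Set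 $q^{[0]}=q$, $r^{[0]}=r$, $\Phi_i^{[0]}=\Phi_i$, and for $k=0,\dots,n-1$ let $h_{k+1}^{[k]}=f_{k+1}^{[k]}/g_{k+1}^{[k]}$, where $f_{k+1}^{[k]}$ and $g_{k+1}^{[k]}$ are assumed to have no zeros in $\Omega$; let $H^{[k]}$ be a nowhere vanishing differentiable function on $\Omega$ with $$H^{[k]}_x=\tfrac{\mathrm i}2H^{[k]}q^{[k]}r^{[k]},\qquad H^{[k]}_t=-\tfrac14H^{[k]}\bigl(\mathrm i (q^{[k]})^2(r^{[k]})^2-2q^{[k]}r^{[k]}_x+2r^{[k]}q^{[k]}_x\bigr)$$ (that is, $H^{[k]}$ is the exponential of an integral of the closed form $\frac{\mathrm i}2q^{[k]}r^{[k]}\,dx-\frac14(\dots)\,dt$); choose differentiable branches of $\sqrt{H^{[k]}}$ and $\sqrt{h^{[k]}_{k+1}}$ on $\Omega$ (assumed to exist, which is automatic if $\Omega$ is simply connected); and put $$T_1^{[k]}(\lambda;\lambda_{k+1})=\begin{pmatrix}\sqrt{H^{[k]}}&0\\0&\frac1{\sqrt{H^{[k]}}}\end{pmatrix}\begin{pmatrix}\frac{\lambda}{\sqrt{h^{[k]}_{k+1}}}&-\lambda_{k+1}\sqrt{h^{[k]}_{k+1}}\\-\frac{\lambda_{k+1}}{\sqrt{h^{[k]}_{k+1}}}&\lambda\sqrt{h^{[k]}_{k+1}}\end{pmatrix},$$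 $$q^{[k+1]}=\frac{H^{[k]}}{h_{k+1}^{[k]}}\bigl(q^{[k]}-2\mathrm i\lambda_{k+1}h_{k+1}^{[k]}\bigr),\quad r^{[k+1]}=\frac{h_{k+1}^{[k]}}{H^{[k]}}\Bigl(r^{[k]}-2\mathrm i\frac{\lambda_{k+1}}{h_{k+1}^{[k]}}\Bigr),\quad \Phi_i^{[k+1]}=T_1^{[k]}(\lambda_i;\lambda_{k+1})\Phi_i^{[k]} .$$ Write $H=H^{[0]}$; the free multiplicative constants in $H^{[1]},\dots,H^{[n-1]}$ are fixed by $H^{[k+1]}/h^{[k]}_{k+1}=1$ at $(x_0,t_0)$ for $0\le k\le n-2$. Let $T_n=T_1^{[n-1]}\cdots T_1^{[1]}T_1^{[0]}$. Let $W_n,\widehat{W_n},M_n,\widehat{M_n}$ be the $n\times n$ matrices whose $i$-th rows are, with the powers of $\lambda_i$ decreasing to $\lambda_i^0$ and with $f_i,g_i$ alternating up to the last column (in $M_n,\widehat{M_n}$: from the second column on; $M_1=(\lambda_1f_1)$, $\widehat{M_1}=(\lambda_1g_1)$), $$\begin{aligned}W_n&:\ \lambda_i^{n-1}f_i,\ \lambda_i^{n-2}g_i,\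 \lambda_i^{n-3}f_i,\ \dots&\widehat{W_n}&:\ \lambda_i^{n-1}g_i,\ \lambda_i^{n-2}f_i,\ \lambda_i^{n-3}g_i,\ \dots\\ M_n&:\ \lambda_i^{n}f_i,\ \lambda_i^{n-2}f_i,\ \lambda_i^{n-3}g_i,\ \dots&\widehat{M_n}&:\ \lambda_i^{n}g_i,\ \lambda_i^{n-2}g_i,\ \lambda_i^{n-3}f_i,\ \dots\end{aligned}$$ Then $(q^{[n]},r^{[n]})$ is a $C^2$ solution of the coupled DNLSII equations on $\Omega$. It is generated from $(q,r)$ by $T_n$: the entries of $T_n$ are differentiable, and with $U^{[n]},V^{[n]}$ denoting $U,V$ with $(q,r)$ replaced by $(q^{[n]},r^{[n]})$ one has, for all $\lambda\in\mathbb C$, $$T_{n,x}+T_nU=U^{[n]}T_n,\qquad T_{n,t}+T_nV=V^{[n]}T_n ,$$ and $(q^{[n]},r^{[n]})$ is the only pair of functions on $\Omega$ for which the first of these relations holds for all $\lambda$. Finally $|W_n|$ and $|\widehat{W_n}|$ have no zeros in $\Omega$, and $$q^{[n]}=\frac{|\widehat{W_n}|}{|W_n|}q-2\mathrm i\frac{|M_n|}{|W_n|},\qquad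 r^{[n]}=\frac{|W_n|}{|\widehat{W_n}|}r-2\mathrm i\frac{|\widehat{M_n}|}{|\widehat{W_n}|}\qquad\text{if } n \text{ is even},$$ $$q^{[n]}=H\Bigl(\frac{|\widehat{W_n}|}{|W_n|}q-2\mathrm i\frac{|M_n|}{|W_n|}\Bigr),\qquad r^{[n]}=\frac1H\Bigl(\frac{|W_n|}{|\widehat{W_n}|}r-2\mathrm i\frac{|\widehat{M_n}|}{|\widehat{W_n}|}\Bigr)\qquad\text{if } n \text{ is odd}.$$ -/

import Mathlib

open Complex

noncomputable section

namespace DNLSII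

/-- Complex-valued functions of the two real variables `(x, t)`. -/
abbrev Fld : Type := ℝ × ℝ → ℂ

/-- Partial derivative in `x`. -/
def dx (u : Fld) (p : ℝ × ℝ) : ℂ := deriv (fun s : ℝ => u (s, p.2)) p.1

/-- Partial derivative in `t`. -/
def dt (u : Fld) (p : ℝ × ℝ) : ℂ := deriv (fun s : ℝ => u (p.1, s)) p.2

/-- `(q, r)` is a classical solution, on the set `Ω`, of the coupled DNLSII equations
`i q_t + q_xx + i q r q_x = 0` and `i r_t - r_xx + i r q r_x = 0`. -/
def IsSolution (Ω : Set (ℝ × ℝ)) (q r : Fld) : Prop :=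
  ContDiffOn ℝ 2 q Ω ∧ ContDiffOn ℝ 2 r Ω ∧
    ∀ p ∈ Ω,
      I * dt q p + dx (dx q) p + I * q p * r p * dx q p = 0 ∧
      I * dt r p - dx (dx r) p + I * r p * q p * dx r p = 0

def matJ : Matrix (Fin 2) (Fin 2) ℂ := !![1, 0; 0, -1]

def matQ (q r : Fld) (p : ℝ × ℝ) : Matrix (Fin 2) (Fin 2) ℂ := !![0, q p; -r p, 0]

def matW (q r : Fld) (p : ℝ × ℝ) : Matrix (Fin 2) (Fin 2) ℂ :=
  !![0, I * dx q p - 1 / 2 * q p ^ 2 * r p; I * dx r p + 1 / 2 * r p ^ 2 * q p, 0]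

/-- The matrix of the `x`-part of the Lax pair, with spectral parameter `z`. -/
def laxU (q r : Fld) (z : ℂ) (p : ℝ × ℝ) : Matrix (Fin 2) (Fin 2) ℂ :=
  (-I * z ^ 2 + I / 4 * q p * r p) • matJ + z • matQ q r p

/-- The matrix of the `t`-part of the Lax pair, with spectral parameter `z`. -/
def laxV (q r : Fld) (z : ℂ) (p : ℝ × ℝ) : Matrix (Fin 2) (Fin 2) ℂ :=
  (-2 * I * z ^ 4 + I * q p * r p * z ^ 2 + 1 / 4 * (q p * dx r p - r p * dx q p)
      - I / 8 * q p ^ 2 * r p ^ 2) • matJ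
    + (2 * z ^ 3) • matQ q r p + z • matW q r p

/-- `Φ = (f, g)ᵀ` is an eigenfunction for the eigenvalue `z`: it solves
`Φ_x = U Φ` and `Φ_t = V Φ` on `Ω`. -/
def IsEigenfunction (Ω : Set (ℝ × ℝ)) (q r : Fld) (z : ℂ) (f g : Fld) : Prop :=
  DifferentiableOn ℝ f Ω ∧ DifferentiableOn ℝ g Ω ∧
    ∀ p ∈ Ω,
      ![dx f p, dx g p] = (laxU q r z p).mulVec ![f p, g p] ∧
      ![dt f p, dt g p] = (laxV q r z p).mulVec ![f p, g p]

/-- `H` is an exponential of the integral of the closed form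
`(i/2) q r dx - (1/4) (i q² r² - 2 q r_x + 2 r q_x) dt`, with any constant of integration:
a nowhere vanishing function on `Ω` with this logarithmic differential. -/
def IsExpIntegral (Ω : Set (ℝ × ℝ)) (q r H : Fld) : Prop :=
  DifferentiableOn ℝ H Ω ∧
    ∀ p ∈ Ω, H p ≠ 0 ∧
      dx H p = 1 / 2 * I * H p * q p * r p ∧
      dt H p = -(1 / 4) * H p *
        (I * q p ^ 2 * r p ^ 2 - 2 * q p * dx r p + 2 * r p * dx q p)

/-- `s` is a differentiable branch of the square root of `u` on `Ω`. -/
def IsSqrtBranch (Ω : Set (ℝ × ℝ)) (u s : Fld) : Prop :=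
  DifferentiableOn ℝ s Ω ∧ ∀ p ∈ Ω, s p ^ 2 = u p

/-- The one-fold Darboux matrix at spectral parameter `z`, generated at the eigenvalue `μ`;
`a` and `b` stand for the values of `√H` and `√h`. -/
def oneFold (μ a b z : ℂ) : Matrix (Fin 2) (Fin 2) ℂ :=
  !![a, 0; 0, 1 / a] * !![z / b, -μ * b; -μ / b, z * b]

/-- The functions which enter the iteration. Indices start at `0`: `lam j`, `f j`, `g j` are the
data of the `(j + 1)`-st eigenfunction, `H k` is the function attached to the `k`-th order
potentials, `sqrtH k` a branch of its square root, and `sqrth k` a branch of the square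
root of the ratio of the components of the `k`-th order eigenfunction number `k + 1`. -/
structure DarbouxData where
  q : Fld
  r : Fld
  lam : ℕ → ℂ
  f : ℕ → Fld
  g : ℕ → Fld
  H : ℕ → Fld
  sqrtH : ℕ → Fld
  sqrth : ℕ → Fld

/-- Potentials together with a sequence of eigenfunctions `(f i, g i)ᵀ`. -/
structure Level where
  q : Fld
  r : Fld
  f : ℕ → Fld
  g : ℕ → Fld

namespace DarbouxData

variable (D : DarbouxData)

/-- The `k`-th order potentials and eigenfunctions, obtained by iterating the one-fold Darboux
transformation: step `k + 1` is generated by the `k`-th order eigenfunction number `k + 1`. -/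
def level : ℕ → Level
  | 0 => ⟨D.q, D.r, D.f, D.g⟩
  | k + 1 =>
    let S := level k
    let h : Fld := fun p => S.f k p / S.g k p
    let Φ : ℕ → ℝ × ℝ → Fin 2 → ℂ := fun i p =>
      (oneFold (D.lam k) (D.sqrtH k p) (D.sqrth k p) (D.lam i)).mulVec ![S.f i p, S.g i p]
    { q := fun p => D.H k p / h p * (S.q p - 2 * I * D.lam k * h p)
      r := fun p => h p / D.H k p * (S.r p - 2 * I * (D.lam k / h p))
      f := fun i p => Φ i p 0
      g := fun i p => Φ i p 1 }

/-- The `k`-th order potential `q^[k]`. -/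
def qn (k : ℕ) : Fld := (D.level k).q

/-- The `k`-th order potential `r^[k]`. -/
def rn (k : ℕ) : Fld := (D.level k).r

/-- First component of the `k`-th order eigenfunction number `i + 1`. -/
def fn (k i : ℕ) : Fld := (D.level k).f i

/-- Second component of the `k`-th order eigenfunction number `i + 1`. -/
def gn (k i : ℕ) : Fld := (D.level k).g i

/-- The ratio of the components of the eigenfunction that generates step `k + 1`. -/
def ratio (k : ℕ) : Fld := fun p => D.fn k k p / D.gn k k p

/-- The `n`-fold Darboux matrix, the product of the first `n` one-fold matrices
(the last step on the left). -/
def darbouxMatrix : ℕ → ℂ → ℝ × ℝ → Matrix (Fin 2) (Fin 2) ℂ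
  | 0, _, _ => 1
  | k + 1, z, p =>
    oneFold (D.lam k) (D.sqrtH k p) (D.sqrth k p) z * darbouxMatrix k z p

/-- Rows `λ^{n-1} f, λ^{n-2} g, λ^{n-3} f, λ^{n-4} g, …`. -/
def W (n : ℕ) (p : ℝ × ℝ) : Matrix (Fin n) (Fin n) ℂ :=
  Matrix.of fun i j =>
    D.lam i ^ (n - 1 - (j : ℕ)) * (if Even (j : ℕ) then D.f i p else D.g i p)

/-- Rows `λ^{n-1} g, λ^{n-2} f, λ^{n-3} g, λ^{n-4} f, …`. -/
def What (n : ℕ) (p : ℝ × ℝ) : Matrix (Fin n) (Fin n) ℂ :=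
  Matrix.of fun i j =>
    D.lam i ^ (n - 1 - (j : ℕ)) * (if Even (j : ℕ) then D.g i p else D.f i p)

/-- Rows `λ^n f, λ^{n-2} f, λ^{n-3} g, λ^{n-4} f, …`. -/
def M (n : ℕ) (p : ℝ × ℝ) : Matrix (Fin n) (Fin n) ℂ :=
  Matrix.of fun i j =>
    if (j : ℕ) = 0 then D.lam i ^ n * D.f i p
    else D.lam i ^ (n - 1 - (j : ℕ)) * (if Even (j : ℕ) then D.g i p else D.f i p)

/-- Rows `λ^n g, λ^{n-2} g, λ^{n-3} f, λ^{n-4} g, …`. -/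
def Mhat (n : ℕ) (p : ℝ × ℝ) : Matrix (Fin n) (Fin n) ℂ :=
  Matrix.of fun i j =>
    if (j : ℕ) = 0 then D.lam i ^ n * D.g i p
    else D.lam i ^ (n - 1 - (j : ℕ)) * (if Even (j : ℕ) then D.f i p else D.g i p)

end DarbouxData

/-- `T_x + T U = U' T` on `Ω` for every value of the spectral parameter, where `U'` is `U` with
`(q, r)` replaced by `(q', r')`. -/
def IntertwinesX (Ω : Set (ℝ × ℝ)) (T : ℂ → ℝ × ℝ → Matrix (Fin 2) (Fin 2) ℂ)
    (q r q' r' : Fld) : Prop :=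
  ∀ z : ℂ, ∀ p ∈ Ω,
    Matrix.of (fun i j => dx (fun s => T z s i j) p) + T z p * laxU q r z p
      = laxU q' r' z p * T z p

/-- `T_t + T V = V' T` on `Ω` for every value of the spectral parameter, where `V'` is `V` with
`(q, r)` replaced by `(q', r')`. -/
def IntertwinesT (Ω : Set (ℝ × ℝ)) (T : ℂ → ℝ × ℝ → Matrix (Fin 2) (Fin 2) ℂ)
    (q r q' r' : Fld) : Prop :=
  ∀ z : ℂ, ∀ p ∈ Ω,
    Matrix.of (fun i j => dt (fun s => T z s i j) p) + T z p * laxV q r z p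
      = laxV q' r' z p * T z p

end DNLSII

end

open Complex

noncomputable section

namespace DNLSII

/-! One step depends on its generating eigenfunction only through `h = f / g`, which solves a
Riccati system. With this system and the defining equations of `H`, all derivatives of `h` and `H`
become rational expressions in `h`, `H`, `q`, `r`, `q_x`, `r_x`. So the statements that a step
preserves the equations (`isSolution_step`) and that the one-fold matrix intertwines the Lax pairs
(`IsStep.intertwinesX`, `IsStep.intertwinesT`) are algebraic identities. Intertwining matrices
multiply and carry eigenfunctions to eigenfunctions (`IsEigenfunction.map`), so the step can be
iterated.

For the determinants, each row of the `k`-fold matrix is polynomial in `λ`, with parity alternating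
between `f` and `g`. Only the two leading coefficients of a row enter the new potentials
(`exists_coeffs`). The matrix annihilates the first `k` eigenfunctions at their eigenvalues, and
these linear equations give `c 1 / c 0` by Cramer's rule (`det_wronski_updateCol`). The leading
coefficient satisfies `c 0 ^ 2 = ∏ H_i / h_i`. The logarithmic differential of `h_k` is that of
`H_{k+1}`, so the normalisation forces `H_{k+1} = h_k` (`IsStep.next_eq`) and the product
telescopes. A recursion between the two families of determinants (`det_wronski_succ`) then expresses
it through `What / W`, with a factor `H` appearing exactly for odd `n`.

Uniqueness holds because the `n`-fold matrix is invertible at some `z ≠ 0`, where `laxU` determines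
its potentials. -/

/-! ### Calculus of the partial derivatives `dx` and `dt` -/

theorem hasDerivAt_slice_x {u : Fld} {p : ℝ × ℝ} (h : DifferentiableAt ℝ u p) :
    HasDerivAt (fun s : ℝ => u (s, p.2)) (dx u p) p.1 := by
  have : DifferentiableAt ℝ (fun s : ℝ => u (s, p.2)) p.1 :=
    DifferentiableAt.comp (g := u) p.1 h (by fun_prop)
  exact this.hasDerivAt

theorem hasDerivAt_slice_t {u : Fld} {p : ℝ × ℝ} (h : DifferentiableAt ℝ u p) :
    HasDerivAt (fun s : ℝ => u (p.1, s)) (dt u p) p.2 := by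
  have : DifferentiableAt ℝ (fun s : ℝ => u (p.1, s)) p.2 :=
    DifferentiableAt.comp (g := u) p.2 h (by fun_prop)
  exact this.hasDerivAt

theorem dx_eq_fderiv {u : Fld} {p : ℝ × ℝ} (h : DifferentiableAt ℝ u p) :
    dx u p = fderiv ℝ u p (1, 0) := by
  have h2 : HasDerivAt (fun s : ℝ => ((s, p.2) : ℝ × ℝ)) (1, 0) p.1 :=
    (hasDerivAt_id _).prodMk (hasDerivAt_const _ _)
  exact (HasFDerivAt.comp_hasDerivAt p.1 (l := u) (f := fun s : ℝ => ((s, p.2) : ℝ × ℝ))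
    h.hasFDerivAt h2).deriv

theorem dt_eq_fderiv {u : Fld} {p : ℝ × ℝ} (h : DifferentiableAt ℝ u p) :
    dt u p = fderiv ℝ u p (0, 1) := by
  have h2 : HasDerivAt (fun s : ℝ => ((p.1, s) : ℝ × ℝ)) (0, 1) p.2 :=
    (hasDerivAt_const _ _).prodMk (hasDerivAt_id _)
  exact (HasFDerivAt.comp_hasDerivAt p.2 (l := u) (f := fun s : ℝ => ((p.1, s) : ℝ × ℝ))
    h.hasFDerivAt h2).deriv

theorem fderiv_eq_dx_dt {u : Fld} {p : ℝ × ℝ} (h : DifferentiableAt ℝ u p) :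
    fderiv ℝ u p = (ContinuousLinearMap.fst ℝ ℝ ℝ).smulRight (dx u p)
      + (ContinuousLinearMap.snd ℝ ℝ ℝ).smulRight (dt u p) := by
  rw [dx_eq_fderiv h, dt_eq_fderiv h]
  ext <;> simp

variable {Ω : Set (ℝ × ℝ)}

theorem differentiableOn_div {u v : Fld} (hu : DifferentiableOn ℝ u Ω)
    (hv : DifferentiableOn ℝ v Ω) (h0 : ∀ p ∈ Ω, v p ≠ 0) :
    DifferentiableOn ℝ (fun p => u p / v p) Ω := by
  simp only [div_eq_mul_inv]
  exact hu.fun_mul (hv.fun_inv h0)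

theorem dx_congr (hΩ : IsOpen Ω) {u v : Fld} (h : Set.EqOn u v Ω) {p : ℝ × ℝ} (hp : p ∈ Ω) :
    dx u p = dx v p := by
  refine Filter.EventuallyEq.deriv_eq ?_
  have hc : ContinuousAt (fun s : ℝ => ((s, p.2) : ℝ × ℝ)) p.1 := by fun_prop
  filter_upwards [hc.preimage_mem_nhds (hΩ.mem_nhds hp)] with s hs using h hs

theorem dt_congr (hΩ : IsOpen Ω) {u v : Fld} (h : Set.EqOn u v Ω) {p : ℝ × ℝ} (hp : p ∈ Ω) :
    dt u p = dt v p := by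
  refine Filter.EventuallyEq.deriv_eq ?_
  have hc : ContinuousAt (fun s : ℝ => ((p.1, s) : ℝ × ℝ)) p.2 := by fun_prop
  filter_upwards [hc.preimage_mem_nhds (hΩ.mem_nhds hp)] with s hs using h hs

theorem contDiffOn_succ_of_dx_dt (hΩ : IsOpen Ω) {u : Fld} {n : ℕ} (hu : DifferentiableOn ℝ u Ω)
    (hx : ContDiffOn ℝ n (dx u) Ω) (ht : ContDiffOn ℝ n (dt u) Ω) :
    ContDiffOn ℝ (n + 1 : ℕ) u Ω := by
  push_cast
  rw [contDiffOn_succ_iff_fderiv_of_isOpen hΩ]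
  refine ⟨hu, by simp, ?_⟩
  refine ContDiffOn.congr (f := fun p => (ContinuousLinearMap.fst ℝ ℝ ℝ).smulRight (dx u p)
      + (ContinuousLinearMap.snd ℝ ℝ ℝ).smulRight (dt u p)) ?_
      fun p hp => fderiv_eq_dx_dt (hu.differentiableAt (hΩ.mem_nhds hp))
  exact (contDiffOn_const.smulRight hx).add (contDiffOn_const.smulRight ht)

theorem contDiffOn_dx (hΩ : IsOpen Ω) {u : Fld} (hu : ContDiffOn ℝ 2 u Ω) :
    ContDiffOn ℝ 1 (dx u) Ω := by
  have h1 := (contDiffOn_succ_iff_fderiv_of_isOpen (n := 1) hΩ).1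
    (show ContDiffOn ℝ (1 + 1) u Ω by norm_num; exact hu)
  exact (h1.2.2.clm_apply contDiffOn_const).congr
    fun p hp => dx_eq_fderiv (h1.1.differentiableAt (hΩ.mem_nhds hp))

theorem eq_of_dx_dt_eq_zero (hΩ : IsOpen Ω) (hc : IsPreconnected Ω) {u : Fld}
    (hu : DifferentiableOn ℝ u Ω) (hx : ∀ p ∈ Ω, dx u p = 0) (ht : ∀ p ∈ Ω, dt u p = 0)
    {p p₀ : ℝ × ℝ} (hp : p ∈ Ω) (hp₀ : p₀ ∈ Ω) : u p = u p₀ := by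
  refine hΩ.is_const_of_fderiv_eq_zero hc hu (fun s hs => ?_) hp hp₀
  rw [fderiv_eq_dx_dt (hu.differentiableAt (hΩ.mem_nhds hs)), hx s hs, ht s hs]
  ext <;> simp

/-! ### The Riccati system and regularity of `h` and `H` -/

/-- `h` is a nowhere vanishing solution on `Ω` of the Riccati system that is satisfied by the
ratio of the components of an eigenfunction for the eigenvalue `μ`. -/
def IsRiccati (Ω : Set (ℝ × ℝ)) (q r : Fld) (μ : ℂ) (h : Fld) : Prop :=
  DifferentiableOn ℝ h Ω ∧ ∀ p ∈ Ω, h p ≠ 0 ∧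
    dx h p = 2 * (-I * μ ^ 2 + I / 4 * q p * r p) * h p + μ * q p + μ * r p * h p ^ 2 ∧
    dt h p = 2 * (-2 * I * μ ^ 4 + I * q p * r p * μ ^ 2 + 1 / 4 * (q p * dx r p - r p * dx q p)
        - I / 8 * q p ^ 2 * r p ^ 2) * h p
      + (2 * μ ^ 3 * q p + μ * (I * dx q p - 1 / 2 * q p ^ 2 * r p))
      - (-2 * μ ^ 3 * r p + μ * (I * dx r p + 1 / 2 * r p ^ 2 * q p)) * h p ^ 2

theorem IsEigenfunction.isRiccati (hΩ : IsOpen Ω) {q r f g : Fld} {μ : ℂ}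
    (h : IsEigenfunction Ω q r μ f g) (h0 : ∀ p ∈ Ω, f p ≠ 0 ∧ g p ≠ 0) :
    IsRiccati Ω q r μ (fun p => f p / g p) := by
  obtain ⟨hf, hg, he⟩ := h
  refine ⟨differentiableOn_div hf hg fun p hp => (h0 p hp).2,
    fun p hp => ⟨div_ne_zero (h0 p hp).1 (h0 p hp).2, ?_⟩⟩
  have hg0 := (h0 p hp).2
  have hfd := hf.differentiableAt (hΩ.mem_nhds hp)
  have hgd := hg.differentiableAt (hΩ.mem_nhds hp)
  obtain ⟨hx, ht⟩ := he p hp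
  have hx0 := congrFun hx 0
  have hx1 := congrFun hx 1
  have ht0 := congrFun ht 0
  have ht1 := congrFun ht 1
  simp [laxU, laxV, matJ, matQ, matW, Matrix.mulVec, dotProduct, Fin.sum_univ_two]
    at hx0 hx1 ht0 ht1
  constructor
  · refine ((hasDerivAt_slice_x hfd).fun_div (hasDerivAt_slice_x hgd) hg0).deriv.trans ?_
    simp only [hx0, hx1, Prod.mk.eta]
    field_simp
    ring
  · refine ((hasDerivAt_slice_t hfd).fun_div (hasDerivAt_slice_t hgd) hg0).deriv.trans ?_
    simp only [ht0, ht1, Prod.mk.eta]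
    field_simp
    ring

/-- Bootstrapping: both partial derivatives are polynomials in `h`, `q`, `r`, `q_x`, `r_x`, so `C^n`
regularity of `h` improves to `C^(n+1)`. The gain stops at `C^2`, since `q_x` and `r_x` are only
`C^1`. -/
theorem IsRiccati.contDiffOn (hΩ : IsOpen Ω) {q r h : ℝ × ℝ → ℂ} {μ : ℂ}
    (hq : ContDiffOn ℝ 2 q Ω) (hr : ContDiffOn ℝ 2 r Ω) (hh : IsRiccati Ω q r μ h) :
    ContDiffOn ℝ 2 h Ω := by
  have hqx := contDiffOn_dx hΩ hq
  have hrx := contDiffOn_dx hΩ hr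
  have key : ∀ n : ℕ, n ≤ 1 → ContDiffOn ℝ n h Ω → ContDiffOn ℝ (n + 1 : ℕ) h Ω := by
    intro n hn hhn
    have h1 : (n : WithTop ℕ∞) ≤ 1 := by exact_mod_cast hn
    have h2 : (n : WithTop ℕ∞) ≤ 2 := by exact_mod_cast hn.trans one_le_two
    replace hq := hq.of_le h2
    replace hr := hr.of_le h2
    replace hqx := hqx.of_le h1
    replace hrx := hrx.of_le h1
    refine contDiffOn_succ_of_dx_dt hΩ hh.1 (ContDiffOn.congr ?_ fun p hp => (hh.2 p hp).2.1)
      (ContDiffOn.congr ?_ fun p hp => (hh.2 p hp).2.2) <;> fun_prop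
  exact key 1 le_rfl (key 0 zero_le_one (by simpa using hh.1.continuousOn))

theorem IsExpIntegral.contDiffOn (hΩ : IsOpen Ω) {q r H : ℝ × ℝ → ℂ}
    (hq : ContDiffOn ℝ 2 q Ω) (hr : ContDiffOn ℝ 2 r Ω) (hH : IsExpIntegral Ω q r H) :
    ContDiffOn ℝ 2 H Ω := by
  have hqx := contDiffOn_dx hΩ hq
  have hrx := contDiffOn_dx hΩ hr
  have key : ∀ n : ℕ, n ≤ 1 → ContDiffOn ℝ n H Ω → ContDiffOn ℝ (n + 1 : ℕ) H Ω := by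
    intro n hn hhn
    have h1 : (n : WithTop ℕ∞) ≤ 1 := by exact_mod_cast hn
    have h2 : (n : WithTop ℕ∞) ≤ 2 := by exact_mod_cast hn.trans one_le_two
    replace hq := hq.of_le h2
    replace hr := hr.of_le h2
    replace hqx := hqx.of_le h1
    replace hrx := hrx.of_le h1
    refine contDiffOn_succ_of_dx_dt hΩ hH.1 (ContDiffOn.congr ?_ fun p hp => (hH.2 p hp).2.1)
      (ContDiffOn.congr ?_ fun p hp => (hH.2 p hp).2.2) <;> fun_prop
  exact key 1 le_rfl (key 0 zero_le_one (by simpa using hH.1.continuousOn))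

/-! ### One step preserves the equations -/

/-- The first potential produced by a one-fold step with `H` and `h` at the eigenvalue `μ`. -/
def stepQ (q H h : Fld) (μ : ℂ) : Fld := fun p => H p / h p * (q p - 2 * I * μ * h p)

/-- The second potential produced by a one-fold step with `H` and `h` at the eigenvalue `μ`. -/
def stepR (r H h : Fld) (μ : ℂ) : Fld := fun p => h p / H p * (r p - 2 * I * (μ / h p))

section Step

variable {q r H h : Fld} {μ : ℂ} {p : ℝ × ℝ}

/-- The terms containing `r` cancel between `H_x` and `h_x`. The closed form, free of derivatives of
`h` and `H`, can be differentiated once more to reach the second derivative. -/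
theorem dx_stepQ (hΩ : IsOpen Ω) (hq : DifferentiableOn ℝ q Ω) (hh : IsRiccati Ω q r μ h)
    (hH : IsExpIntegral Ω q r H) (hp : p ∈ Ω) :
    dx (stepQ q H h μ) p = H p / h p * (2 * I * μ ^ 2 * q p - μ * q p ^ 2 / h p + dx q p) := by
  obtain ⟨h0, hhx, -⟩ := hh.2 p hp
  obtain ⟨H0, hHx, -⟩ := hH.2 p hp
  have dq := hasDerivAt_slice_x (hq.differentiableAt (hΩ.mem_nhds hp))
  have dh := hasDerivAt_slice_x (hh.1.differentiableAt (hΩ.mem_nhds hp))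
  have dH := hasDerivAt_slice_x (hH.1.differentiableAt (hΩ.mem_nhds hp))
  refine ((dH.fun_div dh h0).fun_mul (dq.fun_sub (dh.const_mul (2 * I * μ)))).deriv.trans ?_
  simp only [hhx, hHx, Prod.mk.eta]
  field_simp
  ring_nf
  simp only [I_sq]
  ring

theorem dx_stepR (hΩ : IsOpen Ω) (hr : DifferentiableOn ℝ r Ω) (hh : IsRiccati Ω q r μ h)
    (hH : IsExpIntegral Ω q r H) (hp : p ∈ Ω) :
    dx (stepR r H h μ) p = h p / H p * (-2 * I * μ ^ 2 * r p + μ * r p ^ 2 * h p + dx r p) := by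
  obtain ⟨h0, hhx, -⟩ := hh.2 p hp
  obtain ⟨H0, hHx, -⟩ := hH.2 p hp
  have dr := hasDerivAt_slice_x (hr.differentiableAt (hΩ.mem_nhds hp))
  have dh := hasDerivAt_slice_x (hh.1.differentiableAt (hΩ.mem_nhds hp))
  have dH := hasDerivAt_slice_x (hH.1.differentiableAt (hΩ.mem_nhds hp))
  refine ((dh.fun_div dH H0).fun_mul
    (dr.fun_sub (((hasDerivAt_const _ μ).fun_div dh h0).const_mul (2 * I)))).deriv.trans ?_
  simp only [hhx, hHx, Prod.mk.eta]
  field_simp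
  ring_nf
  simp only [I_sq]
  ring

theorem isSolution_step (hΩ : IsOpen Ω) (hs : IsSolution Ω q r) (hh : IsRiccati Ω q r μ h)
    (hH : IsExpIntegral Ω q r H) : IsSolution Ω (stepQ q H h μ) (stepR r H h μ) := by
  obtain ⟨hq, hr, he⟩ := hs
  have ch := hh.contDiffOn hΩ hq hr
  have cH := hH.contDiffOn hΩ hq hr
  have hh0 : ∀ p ∈ Ω, h p ≠ 0 := fun p hp => (hh.2 p hp).1
  have hH0 : ∀ p ∈ Ω, H p ≠ 0 := fun p hp => (hH.2 p hp).1
  refine ⟨?_, ?_, ?_⟩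
  · unfold stepQ
    simp only [div_eq_mul_inv]
    exact (cH.mul (ch.inv hh0)).mul (hq.sub (contDiffOn_const.mul ch))
  · unfold stepR
    simp only [div_eq_mul_inv]
    exact (ch.mul (cH.inv hH0)).mul (hr.sub (contDiffOn_const.mul (contDiffOn_const.mul (ch.inv hh0))))
  intro p hp
  obtain ⟨e1, e2⟩ := he p hp
  obtain ⟨h0, hhx, hht⟩ := hh.2 p hp
  obtain ⟨H0, hHx, hHt⟩ := hH.2 p hp
  have dq := hq.differentiableOn two_ne_zero
  have dr := hr.differentiableOn two_ne_zero
  have dqx := (contDiffOn_dx hΩ hq).differentiableOn one_ne_zero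
  have drx := (contDiffOn_dx hΩ hr).differentiableOn one_ne_zero
  have nb := hΩ.mem_nhds hp
  have q_x := hasDerivAt_slice_x (dq.differentiableAt nb)
  have r_x := hasDerivAt_slice_x (dr.differentiableAt nb)
  have q_xx := hasDerivAt_slice_x (dqx.differentiableAt nb)
  have r_xx := hasDerivAt_slice_x (drx.differentiableAt nb)
  have h_x := hasDerivAt_slice_x (hh.1.differentiableAt nb)
  have H_x := hasDerivAt_slice_x (hH.1.differentiableAt nb)
  have q_t := hasDerivAt_slice_t (dq.differentiableAt nb)
  have r_t := hasDerivAt_slice_t (dr.differentiableAt nb)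
  have h_t := hasDerivAt_slice_t (hh.1.differentiableAt nb)
  have H_t := hasDerivAt_slice_t (hH.1.differentiableAt nb)
  -- The seed equations solved for the time derivatives, so that substitution leaves a rational
  -- identity in which the second derivatives are free.
  have e1' : dt q p = I * dx (dx q) p - q p * r p * dx q p := by
    linear_combination -I * e1 - (dt q p + q p * r p * dx q p) * (-I_sq)
  have e2' : dt r p = -I * dx (dx r) p - q p * r p * dx r p := by
    linear_combination -I * e2 - (dt r p + q p * r p * dx r p) * (-I_sq)
  constructor
  · have hxx : dx (dx (stepQ q H h μ)) p = _ :=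
      (dx_congr hΩ (fun s hs => dx_stepQ hΩ dq hh hH hs) hp).trans
        ((H_x.fun_div h_x h0).fun_mul (((q_x.const_mul (2 * I * μ ^ 2)).fun_sub
          (((q_x.fun_pow 2).const_mul μ).fun_div h_x h0)).fun_add q_xx)).deriv
    have ht : dt (stepQ q H h μ) p = _ :=
      ((H_t.fun_div h_t h0).fun_mul (q_t.fun_sub (h_t.const_mul (2 * I * μ)))).deriv
    rw [hxx, ht, dx_stepQ hΩ dq hh hH hp]
    simp only [hhx, hHx, hht, hHt, Prod.mk.eta, stepQ, stepR, e1']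
    field_simp
    ring_nf
    simp only [I_sq, I_pow_three, I_pow_four]
    ring
  · have hxx : dx (dx (stepR r H h μ)) p = _ :=
      (dx_congr hΩ (fun s hs => dx_stepR hΩ dr hh hH hs) hp).trans
        ((h_x.fun_div H_x H0).fun_mul (((r_x.const_mul (-2 * I * μ ^ 2)).fun_add
          (((r_x.fun_pow 2).const_mul μ).fun_mul h_x)).fun_add r_xx)).deriv
    have ht : dt (stepR r H h μ) p = _ :=
      ((h_t.fun_div H_t H0).fun_mul (r_t.fun_sub
        (((hasDerivAt_const _ μ).fun_div h_t h0).const_mul (2 * I)))).deriv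
    rw [hxx, ht, dx_stepR hΩ dr hh hH hp]
    simp only [hhx, hHx, hht, hHt, Prod.mk.eta, stepQ, stepR, e2']
    field_simp
    ring_nf
    simp only [I_sq, I_pow_three, I_pow_four]
    ring

end Step

/-! ### The one-fold Darboux matrix -/

section DarbouxStep

theorem I_pow_five : I ^ 5 = I := by rw [pow_succ, I_pow_four]; ring

variable {q r H h a b : Fld} {μ : ℂ} {p : ℝ × ℝ}

theorem IsSqrtBranch.dx_eq (hΩ : IsOpen Ω) {u s : Fld} (hs : IsSqrtBranch Ω u s) (hp : p ∈ Ω)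
    (h0 : s p ≠ 0) : dx s p = dx u p / (2 * s p) := by
  have h1 := hasDerivAt_slice_x (hs.1.differentiableAt (hΩ.mem_nhds hp))
  have h2 : dx u p = _ := (dx_congr hΩ (fun x hx => (hs.2 x hx).symm) hp).trans (h1.fun_pow 2).deriv
  rw [h2]
  simp only [Prod.mk.eta]
  field_simp
  norm_num

theorem IsSqrtBranch.dt_eq (hΩ : IsOpen Ω) {u s : Fld} (hs : IsSqrtBranch Ω u s) (hp : p ∈ Ω)
    (h0 : s p ≠ 0) : dt s p = dt u p / (2 * s p) := by
  have h1 := hasDerivAt_slice_t (hs.1.differentiableAt (hΩ.mem_nhds hp))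
  have h2 : dt u p = _ := (dt_congr hΩ (fun x hx => (hs.2 x hx).symm) hp).trans (h1.fun_pow 2).deriv
  rw [h2]
  simp only [Prod.mk.eta]
  field_simp
  norm_num

theorem oneFold_zero_zero (μ a b z : ℂ) : oneFold μ a b z 0 0 = a * z / b := by
  simp [oneFold]; ring
theorem oneFold_zero_one (μ a b z : ℂ) : oneFold μ a b z 0 1 = -μ * a * b := by
  simp [oneFold]; ring
theorem oneFold_one_zero (μ a b z : ℂ) : oneFold μ a b z 1 0 = -μ / a / b := by
  simp [oneFold]; ring
theorem oneFold_one_one (μ a b z : ℂ) : oneFold μ a b z 1 1 = z * b / a := by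
  simp [oneFold]; ring

/-- The data and hypotheses of a one-fold Darboux step on `Ω`. -/
structure IsStep (Ω : Set (ℝ × ℝ)) (q r H h a b : Fld) (μ : ℂ) : Prop where
  sol : IsSolution Ω q r
  ric : IsRiccati Ω q r μ h
  exp : IsExpIntegral Ω q r H
  sqrtH : IsSqrtBranch Ω H a
  sqrth : IsSqrtBranch Ω h b

namespace IsStep

theorem a_ne (S : IsStep Ω q r H h a b μ) (hp : p ∈ Ω) : a p ≠ 0 := by
  have h1 := (S.exp.2 p hp).1
  rw [← S.sqrtH.2 p hp] at h1
  exact fun h => h1 (by simp [h])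

theorem b_ne (S : IsStep Ω q r H h a b μ) (hp : p ∈ Ω) : b p ≠ 0 := by
  have h1 := (S.ric.2 p hp).1
  rw [← S.sqrth.2 p hp] at h1
  exact fun h => h1 (by simp [h])

theorem differentiableOn_oneFold (S : IsStep Ω q r H h a b μ) (z : ℂ) (i j : Fin 2) :
    DifferentiableOn ℝ (fun p => oneFold μ (a p) (b p) z i j) Ω := by
  have ha := S.sqrtH.1
  have hb := S.sqrth.1
  fin_cases i <;> fin_cases j <;>
    simp only [Fin.zero_eta, Fin.mk_one, Fin.isValue, oneFold_zero_zero, oneFold_zero_one,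
      oneFold_one_zero, oneFold_one_one]
  · exact differentiableOn_div (ha.mul_const z) hb fun p hp => S.b_ne hp
  · exact (ha.const_mul (-μ)).mul hb
  · exact differentiableOn_div (differentiableOn_div (differentiableOn_const _) ha
      fun p hp => S.a_ne hp) hb fun p hp => S.b_ne hp
  · exact differentiableOn_div (hb.const_mul z) ha fun p hp => S.a_ne hp

theorem intertwinesX (hΩ : IsOpen Ω) (S : IsStep Ω q r H h a b μ) :
    IntertwinesX Ω (fun z p => oneFold μ (a p) (b p) z) q r (stepQ q H h μ) (stepR r H h μ) := by
  intro z p hp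
  have ha0 := S.a_ne hp
  have hb0 := S.b_ne hp
  have hH := S.sqrtH.2 p hp
  have hh := S.sqrth.2 p hp
  -- The logarithmic derivatives of `a` and `b` are half those of `H = a ^ 2` and `h = b ^ 2`; in
  -- these terms each entry is a rational identity in `a`, `b` and `z`.
  have ea : dx a p = a p * (I / 4 * q p * r p) := by
    rw [S.sqrtH.dx_eq hΩ hp ha0, (S.exp.2 p hp).2.1, ← hH]
    field_simp
    ring
  have eb : dx b p = (-I * μ ^ 2 + I / 4 * q p * r p) * b p + μ * q p / (2 * b p)
      + μ * r p * b p ^ 3 / 2 := by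
    rw [S.sqrth.dx_eq hΩ hp hb0, (S.ric.2 p hp).2.1, ← hh]
    field_simp
  have da := hasDerivAt_slice_x (S.sqrtH.1.differentiableAt (hΩ.mem_nhds hp))
  have db := hasDerivAt_slice_x (S.sqrth.1.differentiableAt (hΩ.mem_nhds hp))
  have e00 : dx (fun s => a s * z / b s) p = _ := ((da.mul_const z).fun_div db hb0).deriv
  have e01 : dx (fun s => -μ * a s * b s) p = _ := ((da.const_mul (-μ)).fun_mul db).deriv
  have e10 : dx (fun s => -μ / a s / b s) p = _ :=
    (((hasDerivAt_const _ (-μ)).fun_div da ha0).fun_div db hb0).deriv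
  have e11 : dx (fun s => z * b s / a s) p = _ := ((db.const_mul z).fun_div da ha0).deriv
  ext i j
  fin_cases i <;> fin_cases j <;>
    simp only [Fin.zero_eta, Fin.mk_one, Fin.isValue, Matrix.add_apply, Matrix.of_apply,
      Matrix.mul_apply, Fin.sum_univ_two, oneFold_zero_zero, oneFold_zero_one,
      oneFold_one_zero, oneFold_one_one, e00, e01, e10, e11, ea, eb, Prod.mk.eta] <;>
    simp [laxU, matJ, matQ, stepQ, stepR, ← hH, ← hh] <;>
    field_simp <;> ring_nf <;> simp only [I_sq, I_pow_three] <;> ring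

theorem intertwinesT (hΩ : IsOpen Ω) (S : IsStep Ω q r H h a b μ) :
    IntertwinesT Ω (fun z p => oneFold μ (a p) (b p) z) q r (stepQ q H h μ) (stepR r H h μ) := by
  intro z p hp
  have ha0 := S.a_ne hp
  have hb0 := S.b_ne hp
  have hH := S.sqrtH.2 p hp
  have hh := S.sqrth.2 p hp
  have ea : dt a p = a p * (-(1 / 8) *
        (I * q p ^ 2 * r p ^ 2 - 2 * q p * dx r p + 2 * r p * dx q p)) := by
    rw [S.sqrtH.dt_eq hΩ hp ha0, (S.exp.2 p hp).2.2, ← hH]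
    field_simp
    ring
  have eb : dt b p = (-2 * I * μ ^ 4 + I * q p * r p * μ ^ 2
        + 1 / 4 * (q p * dx r p - r p * dx q p) - I / 8 * q p ^ 2 * r p ^ 2) * b p
      + (2 * μ ^ 3 * q p + μ * (I * dx q p - 1 / 2 * q p ^ 2 * r p)) / (2 * b p)
      - (-2 * μ ^ 3 * r p + μ * (I * dx r p + 1 / 2 * r p ^ 2 * q p)) * b p ^ 3 / 2 := by
    rw [S.sqrth.dt_eq hΩ hp hb0, (S.ric.2 p hp).2.2, ← hh]
    field_simp
  have da := hasDerivAt_slice_t (S.sqrtH.1.differentiableAt (hΩ.mem_nhds hp))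
  have db := hasDerivAt_slice_t (S.sqrth.1.differentiableAt (hΩ.mem_nhds hp))
  have e00 : dt (fun s => a s * z / b s) p = _ := ((da.mul_const z).fun_div db hb0).deriv
  have e01 : dt (fun s => -μ * a s * b s) p = _ := ((da.const_mul (-μ)).fun_mul db).deriv
  have e10 : dt (fun s => -μ / a s / b s) p = _ :=
    (((hasDerivAt_const _ (-μ)).fun_div da ha0).fun_div db hb0).deriv
  have e11 : dt (fun s => z * b s / a s) p = _ := ((db.const_mul z).fun_div da ha0).deriv
  -- Unlike `laxU`, the matrix `laxV` contains the `x`-derivatives of the new potentials.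
  have eq := dx_stepQ hΩ (S.sol.1.differentiableOn two_ne_zero) S.ric S.exp hp
  have er := dx_stepR hΩ (S.sol.2.1.differentiableOn two_ne_zero) S.ric S.exp hp
  ext i j
  fin_cases i <;> fin_cases j <;>
    simp only [Fin.zero_eta, Fin.mk_one, Fin.isValue, Matrix.add_apply, Matrix.of_apply,
      Matrix.mul_apply, Fin.sum_univ_two, oneFold_zero_zero, oneFold_zero_one,
      oneFold_one_zero, oneFold_one_one, e00, e01, e10, e11, ea, eb, Prod.mk.eta] <;>
    simp [laxV, matJ, matQ, matW, eq, er] <;>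
    simp only [stepQ, stepR, ← hH, ← hh] <;>
    field_simp <;> ring_nf <;>
    simp only [I_sq, I_pow_three, I_pow_four, I_pow_five] <;> ring

theorem isSolution (hΩ : IsOpen Ω) (S : IsStep Ω q r H h a b μ) :
    IsSolution Ω (stepQ q H h μ) (stepR r H h μ) :=
  isSolution_step hΩ S.sol S.ric S.exp

/-- The function `H` of the next step, normalised at one point, is `h`. -/
theorem next_eq (hΩ : IsOpen Ω) (S : IsStep Ω q r H h a b μ) (hc : IsPreconnected Ω) {H' : Fld}
    (hH' : IsExpIntegral Ω (stepQ q H h μ) (stepR r H h μ) H') {p₀ : ℝ × ℝ} (hp₀ : p₀ ∈ Ω)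
    (hn : H' p₀ / h p₀ = 1) (hp : p ∈ Ω) : H' p = h p := by
  have hh0 : ∀ p ∈ Ω, h p ≠ 0 := fun p hp => (S.ric.2 p hp).1
  -- Expanding the product of the new potentials turns the equations for `H'` into the Riccati
  -- system for `h` divided by `h`, so `H' / h` is constant on the connected set.
  have key := eq_of_dx_dt_eq_zero (u := fun p => H' p / h p) hΩ hc
    (differentiableOn_div hH'.1 S.ric.1 hh0) (fun p hp => ?_) (fun p hp => ?_) hp hp₀
  · rw [hn] at key
    rw [div_eq_one_iff_eq (hh0 p hp)] at key
    exact key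
  · have d1 := hasDerivAt_slice_x (hH'.1.differentiableAt (hΩ.mem_nhds hp))
    have d2 := hasDerivAt_slice_x (S.ric.1.differentiableAt (hΩ.mem_nhds hp))
    have h0 := hh0 p hp
    have H0 := (S.exp.2 p hp).1
    refine (d1.fun_div d2 h0).deriv.trans ?_
    simp only [(hH'.2 p hp).2.1, (S.ric.2 p hp).2.1, stepQ, stepR, Prod.mk.eta]
    field_simp
    ring_nf
    simp only [I_sq, I_pow_three]
    ring
  · have d1 := hasDerivAt_slice_t (hH'.1.differentiableAt (hΩ.mem_nhds hp))
    have d2 := hasDerivAt_slice_t (S.ric.1.differentiableAt (hΩ.mem_nhds hp))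
    have h0 := hh0 p hp
    have H0 := (S.exp.2 p hp).1
    have eq := dx_stepQ hΩ (S.sol.1.differentiableOn two_ne_zero) S.ric S.exp hp
    have er := dx_stepR hΩ (S.sol.2.1.differentiableOn two_ne_zero) S.ric S.exp hp
    refine (d1.fun_div d2 h0).deriv.trans ?_
    simp only [(hH'.2 p hp).2.2, (S.ric.2 p hp).2.2, eq, er, Prod.mk.eta]
    simp only [stepQ, stepR]
    field_simp
    ring_nf
    simp only [I_sq, I_pow_three, I_pow_four, I_pow_five]
    ring

end IsStep
end DarbouxStep

/-! ### Determinants with alternating columns -/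

/-- `u` at even places and `v` at odd places. -/
def alt (j : ℕ) (u v : ℂ) : ℂ := if Even j then u else v

theorem alt_zero (u v : ℂ) : alt 0 u v = u := by simp [alt]

theorem alt_succ (j : ℕ) (u v : ℂ) : alt (j + 1) u v = alt j v u := by
  unfold alt
  split_ifs <;> first | rfl | (exfalso; grind)

/-- The matrix with rows `λ^{n-1} f, λ^{n-2} g, λ^{n-3} f, …`. -/
def wronski (lam f g : ℕ → ℂ) (n : ℕ) : Matrix (Fin n) (Fin n) ℂ :=
  Matrix.of fun i j => lam i ^ (n - 1 - (j : ℕ)) * alt j (f i) (g i)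

/-- Replacing column `0` by the combination of columns with weights `c` multiplies the determinant
by `c 0`. The new column is `F`, zero except in the last row; expanding along it leaves a minor that
starts one column later, which swaps `f` and `g`. -/
theorem det_wronski_succ (lam f g F c : ℕ → ℂ) (m : ℕ)
    (hF : ∀ i ≤ m, ∑ j ∈ Finset.range (m + 1), c j * (lam i ^ (m - j) * alt j (f i) (g i)) = F i)
    (h0 : ∀ i < m, F i = 0) :
    c 0 * (wronski lam f g (m + 1)).det = (-1) ^ m * F m * (wronski lam g f m).det := by
  have h1 := Matrix.det_updateCol_sum (wronski lam f g (m + 1)) 0 (fun j => c j)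
  have h2 : (fun k => ∑ i : Fin (m + 1), c i • wronski lam f g (m + 1) k i)
      = fun k : Fin (m + 1) => F k := by
    funext k
    rw [← hF k (Nat.lt_succ_iff.1 k.2), Finset.sum_range]
    rfl
  rw [h2] at h1
  rw [Fin.val_zero, smul_eq_mul] at h1
  rw [← h1, Matrix.det_succ_column _ 0, Finset.sum_eq_single (Fin.last m)]
  · have h3 : ((wronski lam f g (m + 1)).updateCol 0 fun k => F k).submatrix
        (Fin.last m).succAbove (Fin.succAbove 0) = wronski lam g f m := by
      ext i j
      simp [wronski, alt_succ, Nat.sub_sub, add_comm]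
    rw [h3]
    simp
  · intro i _ hi
    have : (i : ℕ) < m := Fin.val_lt_last hi
    simp [h0 i this]
  · simp

/-- Cramer's rule: moving the leading term of each relation to the other side writes `-c 0 * λ^(m+1)
f` as a combination of the columns of `wronski lam g f`, the first with weight `c 1`. -/
theorem det_wronski_updateCol (lam f g c : ℕ → ℂ) (m : ℕ)
    (hF : ∀ i ≤ m,
      ∑ j ∈ Finset.range (m + 2), c j * (lam i ^ (m + 1 - j) * alt j (f i) (g i)) = 0) :
    c 1 * (wronski lam g f (m + 1)).det
      = -c 0 * ((wronski lam g f (m + 1)).updateCol 0 fun i => lam i ^ (m + 1) * f i).det := by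
  have h1 := Matrix.det_updateCol_sum (wronski lam g f (m + 1)) 0 (fun j => c (j + 1))
  have h2 : (fun k => ∑ i : Fin (m + 1), c (i + 1) • wronski lam g f (m + 1) k i)
      = -c 0 • fun i : Fin (m + 1) => lam i ^ (m + 1) * f i := by
    funext k
    have h3 := hF k (Nat.lt_succ_iff.1 k.2)
    rw [Finset.sum_range_succ', Finset.sum_range] at h3
    simp only [alt_succ, alt_zero, Nat.sub_zero, Nat.add_sub_add_right] at h3
    simp only [wronski, Matrix.of_apply, smul_eq_mul, Pi.smul_apply, Nat.add_sub_cancel]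
    linear_combination h3
  rw [h2, Matrix.det_updateCol_smul] at h1
  simpa using h1.symm

/-! ### Pointwise algebra of the iteration -/

namespace DarbouxData

variable (D : DarbouxData) {n : ℕ} {p : ℝ × ℝ}

theorem W_eq (n : ℕ) (p : ℝ × ℝ) :
    D.W n p = wronski D.lam (fun i => D.f i p) (fun i => D.g i p) n := rfl

theorem What_eq (n : ℕ) (p : ℝ × ℝ) :
    D.What n p = wronski D.lam (fun i => D.g i p) (fun i => D.f i p) n := rfl

theorem M_eq (m : ℕ) (p : ℝ × ℝ) :
    D.M (m + 1) p = (D.What (m + 1) p).updateCol 0 fun i => D.lam i ^ (m + 1) * D.f i p := by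
  ext i j
  refine Fin.cases ?_ (fun j => ?_) j <;> simp [M, What]

theorem Mhat_eq (m : ℕ) (p : ℝ × ℝ) :
    D.Mhat (m + 1) p = (D.W (m + 1) p).updateCol 0 fun i => D.lam i ^ (m + 1) * D.g i p := by
  ext i j
  refine Fin.cases ?_ (fun j => ?_) j <;> simp [Mhat, W]

/-- The relations among the values at the point `p` of the functions of the first `n` steps. -/
structure IsRegularAt (n : ℕ) (p : ℝ × ℝ) : Prop where
  fn_ne : ∀ k < n, D.fn k k p ≠ 0
  gn_ne : ∀ k < n, D.gn k k p ≠ 0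
  H_ne : ∀ k < n, D.H k p ≠ 0
  sqrtH : ∀ k < n, D.sqrtH k p ^ 2 = D.H k p
  sqrth : ∀ k < n, D.sqrth k p ^ 2 = D.ratio k p

theorem fn_succ (k i : ℕ) (p : ℝ × ℝ) : D.fn (k + 1) i p =
    D.sqrtH k p * (D.lam i / D.sqrth k p * D.fn k i p
      - D.lam k * D.sqrth k p * D.gn k i p) := by
  change (oneFold (D.lam k) (D.sqrtH k p) (D.sqrth k p) (D.lam i)).mulVec
    ![D.fn k i p, D.gn k i p] 0 = _
  simp [oneFold, Matrix.mulVec, dotProduct, Fin.sum_univ_two]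
  ring

theorem gn_succ (k i : ℕ) (p : ℝ × ℝ) : D.gn (k + 1) i p =
    1 / D.sqrtH k p * (-D.lam k / D.sqrth k p * D.fn k i p
      + D.lam i * D.sqrth k p * D.gn k i p) := by
  change (oneFold (D.lam k) (D.sqrtH k p) (D.sqrth k p) (D.lam i)).mulVec
    ![D.fn k i p, D.gn k i p] 1 = _
  simp [oneFold, Matrix.mulVec, dotProduct, Fin.sum_univ_two]
  ring

theorem mulVec_darbouxMatrix (k i : ℕ) (p : ℝ × ℝ) :
    (D.darbouxMatrix k (D.lam i) p).mulVec ![D.f i p, D.g i p] = ![D.fn k i p, D.gn k i p] := by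
  induction k with
  | zero => simp [darbouxMatrix]; exact ⟨rfl, rfl⟩
  | succ k ih =>
    rw [darbouxMatrix, ← Matrix.mulVec_mulVec, ih]
    ext j
    fin_cases j <;> rfl

variable {D}

namespace IsRegularAt

theorem ratio_ne (R : D.IsRegularAt n p) {k : ℕ} (hk : k < n) : D.ratio k p ≠ 0 :=
  div_ne_zero (R.fn_ne k hk) (R.gn_ne k hk)

theorem sqrtH_ne (R : D.IsRegularAt n p) {k : ℕ} (hk : k < n) : D.sqrtH k p ≠ 0 := by
  have h1 := R.H_ne k hk
  rw [← R.sqrtH k hk] at h1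
  exact fun h => h1 (by simp [h])

theorem sqrth_ne (R : D.IsRegularAt n p) {k : ℕ} (hk : k < n) : D.sqrth k p ≠ 0 := by
  have h1 := R.ratio_ne hk
  rw [← R.sqrth k hk] at h1
  exact fun h => h1 (by simp [h])

/-- The eigenfunctions used in the first `k` steps are annihilated. -/
theorem fn_gn_eq_zero (R : D.IsRegularAt n p) {k : ℕ} (hk : k ≤ n) {i : ℕ} (hi : i < k) :
    D.fn k i p = 0 ∧ D.gn k i p = 0 := by
  induction k with
  | zero => omega
  | succ k ih =>
    rw [fn_succ, gn_succ]
    rcases Nat.lt_succ_iff_lt_or_eq.1 hi with h | rfl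
    · obtain ⟨h1, h2⟩ := ih (by omega) h
      simp [h1, h2]
    · have hb := R.sqrth_ne hk
      -- At its own eigenvalue the one-fold matrix is singular, and `b ^ 2 = f / g` places the
      -- generating eigenfunction in its kernel.
      have h1 : D.sqrth i p ^ 2 * D.gn i i p = D.fn i i p := by
        rw [R.sqrth i hk, ratio, div_mul_cancel₀ _ (R.gn_ne i hk)]
      rw [← h1]
      constructor <;> field_simp <;> ring

/-- Multiplication by a one-fold matrix raises the degree of each row by one and mixes in the other
row, whose parity pattern is opposite, so the alternating shape persists. The leading coefficients
are reciprocal to each other. Vanishing beyond `k` is recorded so that the recursion needs no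
separate case for the lowest coefficient. -/
theorem exists_coeffs (R : D.IsRegularAt n p) {k : ℕ} (hk : k ≤ n) :
    ∃ c d : ℕ → ℂ, c 0 * d 0 = 1 ∧ (∀ j, k < j → c j = 0 ∧ d j = 0) ∧
      D.qn k p = c 0 * (c 0 * D.q p + 2 * I * c 1) ∧
      D.rn k p = d 0 * (d 0 * D.r p + 2 * I * d 1) ∧
      c 0 ^ 2 = ∏ i ∈ Finset.range k, (D.H i p / D.ratio i p) ∧
      ∀ z u v, (D.darbouxMatrix k z p).mulVec ![u, v] =
        ![∑ j ∈ Finset.range (k + 1), c j * (z ^ (k - j) * alt j u v),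
          ∑ j ∈ Finset.range (k + 1), d j * (z ^ (k - j) * alt j v u)] := by
  induction k with
  | zero =>
    refine ⟨fun j => if j = 0 then 1 else 0, fun j => if j = 0 then 1 else 0, ?_⟩
    simp [darbouxMatrix, alt_zero]
    exact ⟨fun j hj => by omega, rfl, rfl⟩
  | succ k ih =>
    obtain ⟨c, d, hcd, hz, hq, hr, hP, hT⟩ := ih (by omega)
    have ha := R.sqrtH_ne hk
    have hb := R.sqrth_ne hk
    have hH := R.sqrtH k hk
    have hh := R.sqrth k hk
    set a := D.sqrtH k p
    set b := D.sqrth k p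
    set μ := D.lam k
    have hd0 : d 0 = 1 / c 0 := by
      have : c 0 ≠ 0 := left_ne_zero_of_mul_eq_one hcd
      field_simp
      linear_combination hcd
    have hc0 : c 0 ≠ 0 := left_ne_zero_of_mul_eq_one hcd
    -- The polynomial form of one row of the product: multiplying by `z` keeps the index `j` and
    -- appends a zero term, while the other row enters with its index shifted by one.
    have key : ∀ (z u v s t : ℂ) (c d e : ℕ → ℂ), c (k + 1) = 0 → e 0 = s * c 0 →
        (∀ j, e (j + 1) = s * c (j + 1) + t * d j) →
        ∑ j ∈ Finset.range (k + 1 + 1), e j * (z ^ (k + 1 - j) * alt j u v)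
          = s * z * ∑ j ∈ Finset.range (k + 1), c j * (z ^ (k - j) * alt j u v)
            + t * ∑ j ∈ Finset.range (k + 1), d j * (z ^ (k - j) * alt j v u) := by
      intro z u v s t c d e hck h0 hs
      have h1 : z * ∑ j ∈ Finset.range (k + 1), c j * (z ^ (k - j) * alt j u v)
          = ∑ j ∈ Finset.range (k + 1 + 1), c j * (z ^ (k + 1 - j) * alt j u v) := by
        rw [Finset.sum_range_succ _ (k + 1), hck, zero_mul, add_zero, Finset.mul_sum]
        refine Finset.sum_congr rfl fun j hj => ?_
        rw [Nat.succ_sub (Nat.lt_succ_iff.1 (Finset.mem_range.1 hj)), pow_succ]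
        ring
      rw [mul_assoc, h1, Finset.sum_range_succ', Finset.sum_range_succ' _ (k + 1), h0, mul_add,
        Finset.mul_sum, Finset.mul_sum, add_right_comm, ← Finset.sum_add_distrib]
      congr 1
      · refine Finset.sum_congr rfl fun j _ => ?_
        rw [hs, alt_succ, Nat.add_sub_add_right]
        ring
      · ring
    have hex : ∀ (s : ℂ) (v : ℕ → ℂ), ∃ e : ℕ → ℂ, e 0 = s ∧ ∀ j, e (j + 1) = v j :=
      fun s v => ⟨fun j => Nat.casesOn j s v, rfl, fun _ => rfl⟩
    obtain ⟨c', hc0', hc'⟩ := hex (a / b * c 0) fun j => a / b * c (j + 1) + -(a * μ * b) * d j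
    obtain ⟨d', hd0', hd'⟩ := hex (b / a * d 0) fun j => b / a * d (j + 1) + -(μ / (a * b)) * c j
    refine ⟨c', d', ?_, ?_, ?_, ?_, ?_, ?_⟩
    · rw [hc0', hd0', hd0]
      field_simp
    · intro j hj
      obtain ⟨j, rfl⟩ := Nat.exists_eq_succ_of_ne_zero (by omega : j ≠ 0)
      simp [hc', hd', hz j (by omega), hz (j + 1) (by omega)]
    · change D.H k p / D.ratio k p * (D.qn k p - 2 * I * μ * D.ratio k p) = _
      rw [hq, ← hH, ← hh, hc0', show c' 1 = _ from hc' 0, hd0]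
      field_simp
      ring
    · change D.ratio k p / D.H k p * (D.rn k p - 2 * I * (μ / D.ratio k p)) = _
      rw [hr, ← hH, ← hh, hd0', show d' 1 = _ from hd' 0, hd0]
      field_simp
      ring
    · rw [Finset.prod_range_succ, ← hP, ← hH, ← hh, hc0']
      field_simp
    · intro z u v
      rw [darbouxMatrix, ← Matrix.mulVec_mulVec, hT z u v,
        key z u v (a / b) (-(a * μ * b)) c d c' (hz _ (by omega)).1 hc0' hc',
        key z v u (b / a) (-(μ / (a * b))) d c d' (hz _ (by omega)).2 hd0' hd']
      ext j
      fin_cases j <;>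
        simp [oneFold, Matrix.mulVec, dotProduct, Fin.sum_univ_two] <;> ring

theorem prod_mul_fn (R : D.IsRegularAt n p) (hl : ∀ k, k + 1 < n → D.H (k + 1) p = D.ratio k p)
    {m : ℕ} (hm : m < n) :
    (∏ i ∈ Finset.range (m + 1), (D.H i p / D.ratio i p)) * D.fn m m p
      = D.H 0 p * D.gn m m p := by
  -- The product telescopes, since each `H (i + 1)` cancels `ratio i`.
  have h1 : ∏ i ∈ Finset.range (m + 1), (D.H i p / D.ratio i p) = D.H 0 p / D.ratio m p := by
    induction m with
    | zero => simp
    | succ m ih =>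
      rw [Finset.prod_range_succ, ih (by omega), hl m hm]
      have := R.ratio_ne (show m < n by omega)
      field_simp
  have hf := R.fn_ne m hm
  have hg := R.gn_ne m hm
  rw [h1, ratio]
  field_simp

theorem det_ne_zero_and_eq (R : D.IsRegularAt n p)
    (hl : ∀ k, k + 1 < n → D.H (k + 1) p = D.ratio k p) {m : ℕ} (hm : m ≤ n) :
    (D.W m p).det ≠ 0 ∧ (D.What m p).det ≠ 0 ∧
      alt m 1 (D.H 0 p) * (D.What m p).det
        = (∏ i ∈ Finset.range m, (D.H i p / D.ratio i p)) * (D.W m p).det := by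
  induction m with
  | zero => simp [alt_zero]
  | succ m ih =>
    obtain ⟨hW, hV, he⟩ := ih (by omega)
    obtain ⟨c, d, hcd, -, -, -, hP, hT⟩ := R.exists_coeffs (show m ≤ n by omega)
    have hF : ∀ i, _ := fun i => (D.mulVec_darbouxMatrix m i p).symm.trans (hT _ _ _)
    have h1 := det_wronski_succ D.lam (fun i => D.f i p) (fun i => D.g i p)
      (fun i => D.fn m i p) c m (fun i _ => (congrFun (hF i) 0).symm)
      (fun i hi => (R.fn_gn_eq_zero (by omega) hi).1)
    have h2 := det_wronski_succ D.lam (fun i => D.g i p) (fun i => D.f i p)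
      (fun i => D.gn m i p) d m (fun i _ => (congrFun (hF i) 1).symm)
      (fun i hi => (R.fn_gn_eq_zero (by omega) hi).2)
    rw [← W_eq, ← What_eq] at h1 h2
    have hk := R.prod_mul_fn hl (show m < n by omega)
    have hf := R.fn_ne m hm
    have hg := R.gn_ne m hm
    have hs : ((-1 : ℂ)) ^ m ≠ 0 := pow_ne_zero _ (by norm_num)
    have hc0 : c 0 ≠ 0 := left_ne_zero_of_mul_eq_one hcd
    have hd0 : d 0 ≠ 0 := right_ne_zero_of_mul_eq_one hcd
    have hH0 := R.H_ne 0 (by omega)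
    refine ⟨fun h => ?_, fun h => ?_, ?_⟩
    -- The recursion writes `c 0 * det W_(m+1)` as a product of nonzero factors, one of them the
    -- other determinant of size `m`.
    · rw [h, mul_zero] at h1
      exact mul_ne_zero (mul_ne_zero hs hf) hV h1.symm
    · rw [h, mul_zero] at h2
      exact mul_ne_zero (mul_ne_zero hs hg) hW h2.symm
    · rw [← hP] at he
      rw [alt_succ]
      refine mul_left_cancel₀ (mul_ne_zero (mul_ne_zero hd0 hc0)
        (show alt m 1 (D.H 0 p) ≠ 0 by unfold alt; split_ifs <;> simp [hH0])) ?_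
      -- One of the two factors is `1` and the other is `H 0`; this lets the power of `H 0`
      -- alternate with the parity of `m`.
      have hA : alt m 1 (D.H 0 p) * alt m (D.H 0 p) 1 = D.H 0 p := by
        unfold alt; split_ifs <;> simp
      set P := ∏ i ∈ Finset.range (m + 1), (D.H i p / D.ratio i p)
      linear_combination c 0 * (d 0 * (D.What (m + 1) p).det) * hA + c 0 * D.H 0 p * h2
        - d 0 * alt m 1 (D.H 0 p) * P * h1
        - d 0 * P * (-1) ^ m * D.fn m m p * he
        - c 0 * (-1) ^ m * (D.W m p).det * hk
        - c 0 * P * (-1) ^ m * D.fn m m p * (D.W m p).det * hcd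

theorem formulas (R : D.IsRegularAt n p) (hn : 1 ≤ n)
    (hl : ∀ k, k + 1 < n → D.H (k + 1) p = D.ratio k p) :
    D.qn n p = alt n 1 (D.H 0 p) * ((D.What n p).det / (D.W n p).det * D.q p
        - 2 * I * ((D.M n p).det / (D.W n p).det)) ∧
    D.rn n p = 1 / alt n 1 (D.H 0 p) * ((D.W n p).det / (D.What n p).det * D.r p
        - 2 * I * ((D.Mhat n p).det / (D.What n p).det)) := by
  obtain ⟨hW, hV, he⟩ := R.det_ne_zero_and_eq hl le_rfl
  obtain ⟨c, d, hcd, -, hq, hr, hP, hT⟩ := R.exists_coeffs le_rfl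
  obtain ⟨m, rfl⟩ := Nat.exists_eq_add_of_le' hn
  have hF : ∀ i, _ := fun i => (D.mulVec_darbouxMatrix (m + 1) i p).symm.trans (hT _ _ _)
  have h1 := det_wronski_updateCol D.lam (fun i => D.f i p) (fun i => D.g i p) c m
    (fun i hi => (congrFun (hF i) 0).symm.trans (R.fn_gn_eq_zero le_rfl (Nat.lt_succ_iff.2 hi)).1)
  have h2 := det_wronski_updateCol D.lam (fun i => D.g i p) (fun i => D.f i p) d m
    (fun i hi => (congrFun (hF i) 1).symm.trans (R.fn_gn_eq_zero le_rfl (Nat.lt_succ_iff.2 hi)).2)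
  rw [← What_eq, ← M_eq] at h1
  rw [← W_eq, ← Mhat_eq] at h2
  have hc0 : c 0 ≠ 0 := left_ne_zero_of_mul_eq_one hcd
  have hd0 : d 0 = 1 / c 0 := by
    field_simp
    linear_combination hcd
  have hA : alt (m + 1) 1 (D.H 0 p) ≠ 0 := by
    have := R.H_ne 0 (by omega)
    unfold alt; split_ifs <;> simp [this]
  -- Only `c 0 ^ 2` is expressed by determinants. This suffices, because the potentials involve just
  -- `c 0 ^ 2`, its inverse, `c 1 / c 0` and `d 1 / d 0`.
  have hA' : alt (m + 1) 1 (D.H 0 p) = c 0 ^ 2 * (D.W (m + 1) p).det / (D.What (m + 1) p).det := by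
    rw [hP]
    field_simp
    exact he
  have h1' : c 1 = -c 0 * (D.M (m + 1) p).det / (D.What (m + 1) p).det := by
    rw [eq_div_iff hV, h1]
  have h2' : d 1 = -d 0 * (D.Mhat (m + 1) p).det / (D.W (m + 1) p).det := by
    rw [eq_div_iff hW, h2]
  rw [hq, hr, hA', h1', h2', hd0]
  constructor <;> field_simp <;> ring

/-- Each one-fold factor has determinant `z ^ 2 - λ_k ^ 2`, independent of the point. -/
theorem det_darbouxMatrix_ne_zero (R : D.IsRegularAt n p) {k : ℕ} (hk : k ≤ n) {z : ℂ}
    (hz : ∀ i < k, z ^ 2 ≠ D.lam i ^ 2) : (D.darbouxMatrix k z p).det ≠ 0 := by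
  induction k with
  | zero => simp [darbouxMatrix]
  | succ k ih =>
    rw [darbouxMatrix, Matrix.det_mul]
    refine mul_ne_zero ?_ (ih (by omega) fun i hi => hz i (by omega))
    have ha := R.sqrtH_ne hk
    have hb := R.sqrth_ne hk
    have : (oneFold (D.lam k) (D.sqrtH k p) (D.sqrth k p) z).det = z ^ 2 - D.lam k ^ 2 := by
      simp [oneFold, Matrix.det_fin_two]
      field_simp
      ring
    rw [this]
    exact sub_ne_zero.2 (hz k (by omega))

end IsRegularAt
end DarbouxData

/-! ### Composition of intertwining matrices and uniqueness -/

theorem dx_mulVec {A : ℝ × ℝ → Matrix (Fin 2) (Fin 2) ℂ} {f g : Fld} {p : ℝ × ℝ}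
    (hA : ∀ i j, DifferentiableAt ℝ (fun p => A p i j) p) (hf : DifferentiableAt ℝ f p)
    (hg : DifferentiableAt ℝ g p) (i : Fin 2) :
    dx (fun p => (A p).mulVec ![f p, g p] i) p =
      (Matrix.of fun i j => dx (fun s => A s i j) p).mulVec ![f p, g p] i
        + (A p).mulVec ![dx f p, dx g p] i := by
  simp only [Matrix.mulVec, dotProduct, Fin.sum_univ_two, Matrix.of_apply, Matrix.cons_val_zero,
    Matrix.cons_val_one]
  refine (((hasDerivAt_slice_x (hA i 0)).fun_mul (hasDerivAt_slice_x hf)).fun_add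
    ((hasDerivAt_slice_x (hA i 1)).fun_mul (hasDerivAt_slice_x hg))).deriv.trans ?_
  simp only [Prod.mk.eta]
  ring

theorem dt_mulVec {A : ℝ × ℝ → Matrix (Fin 2) (Fin 2) ℂ} {f g : Fld} {p : ℝ × ℝ}
    (hA : ∀ i j, DifferentiableAt ℝ (fun p => A p i j) p) (hf : DifferentiableAt ℝ f p)
    (hg : DifferentiableAt ℝ g p) (i : Fin 2) :
    dt (fun p => (A p).mulVec ![f p, g p] i) p =
      (Matrix.of fun i j => dt (fun s => A s i j) p).mulVec ![f p, g p] i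
        + (A p).mulVec ![dt f p, dt g p] i := by
  simp only [Matrix.mulVec, dotProduct, Fin.sum_univ_two, Matrix.of_apply, Matrix.cons_val_zero,
    Matrix.cons_val_one]
  refine (((hasDerivAt_slice_t (hA i 0)).fun_mul (hasDerivAt_slice_t hf)).fun_add
    ((hasDerivAt_slice_t (hA i 1)).fun_mul (hasDerivAt_slice_t hg))).deriv.trans ?_
  simp only [Prod.mk.eta]
  ring

theorem dx_mul_matrix {A B : ℝ × ℝ → Matrix (Fin 2) (Fin 2) ℂ} {p : ℝ × ℝ}
    (hA : ∀ i j, DifferentiableAt ℝ (fun p => A p i j) p)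
    (hB : ∀ i j, DifferentiableAt ℝ (fun p => B p i j) p) :
    (Matrix.of fun i j => dx (fun s => (A s * B s) i j) p) =
      (Matrix.of fun i j => dx (fun s => A s i j) p) * B p
        + A p * Matrix.of fun i j => dx (fun s => B s i j) p := by
  ext i j
  simp only [Matrix.of_apply, Matrix.add_apply, Matrix.mul_apply, Fin.sum_univ_two]
  refine (((hasDerivAt_slice_x (hA i 0)).fun_mul (hasDerivAt_slice_x (hB 0 j))).fun_add
    ((hasDerivAt_slice_x (hA i 1)).fun_mul (hasDerivAt_slice_x (hB 1 j)))).deriv.trans ?_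
  simp only [Prod.mk.eta]
  ring

theorem dt_mul_matrix {A B : ℝ × ℝ → Matrix (Fin 2) (Fin 2) ℂ} {p : ℝ × ℝ}
    (hA : ∀ i j, DifferentiableAt ℝ (fun p => A p i j) p)
    (hB : ∀ i j, DifferentiableAt ℝ (fun p => B p i j) p) :
    (Matrix.of fun i j => dt (fun s => (A s * B s) i j) p) =
      (Matrix.of fun i j => dt (fun s => A s i j) p) * B p
        + A p * Matrix.of fun i j => dt (fun s => B s i j) p := by
  ext i j
  simp only [Matrix.of_apply, Matrix.add_apply, Matrix.mul_apply, Fin.sum_univ_two]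
  refine (((hasDerivAt_slice_t (hA i 0)).fun_mul (hasDerivAt_slice_t (hB 0 j))).fun_add
    ((hasDerivAt_slice_t (hA i 1)).fun_mul (hasDerivAt_slice_t (hB 1 j)))).deriv.trans ?_
  simp only [Prod.mk.eta]
  ring

/-- An intertwining matrix maps eigenfunctions to eigenfunctions. -/
theorem IsEigenfunction.map (hΩ : IsOpen Ω) {T : ℂ → ℝ × ℝ → Matrix (Fin 2) (Fin 2) ℂ}
    {q r q' r' f g : Fld} {z : ℂ} (hE : IsEigenfunction Ω q r z f g)
    (hT : ∀ i j, DifferentiableOn ℝ (fun p => T z p i j) Ω)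
    (hX : IntertwinesX Ω T q r q' r') (hTt : IntertwinesT Ω T q r q' r') :
    IsEigenfunction Ω q' r' z (fun p => (T z p).mulVec ![f p, g p] 0)
      (fun p => (T z p).mulVec ![f p, g p] 1) := by
  obtain ⟨hf, hg, he⟩ := hE
  have hd : ∀ i, DifferentiableOn ℝ (fun p => (T z p).mulVec ![f p, g p] i) Ω := by
    intro i
    simp only [Matrix.mulVec, dotProduct, Fin.sum_univ_two, Matrix.cons_val_zero,
      Matrix.cons_val_one]
    exact ((hT i 0).mul hf).add ((hT i 1).mul hg)
  have hcons : ∀ v : Fin 2 → ℂ, ![v 0, v 1] = v := fun v => by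
    ext i; fin_cases i <;> rfl
  have hadd : ∀ (A B : Matrix (Fin 2) (Fin 2) ℂ) (v : Fin 2 → ℂ),
      ![A.mulVec v 0 + B.mulVec v 0, A.mulVec v 1 + B.mulVec v 1] = (A + B).mulVec v := by
    intro A B v
    rw [Matrix.add_mulVec]
    exact hcons (A.mulVec v + B.mulVec v)
  refine ⟨hd 0, hd 1, fun p hp => ?_⟩
  have nb := hΩ.mem_nhds hp
  have dT := fun i j => (hT i j).differentiableAt nb
  have df := hf.differentiableAt nb
  have dg := hg.differentiableAt nb
  obtain ⟨ex, et⟩ := he p hp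
  constructor
  · rw [dx_mulVec dT df dg, dx_mulVec dT df dg, ex, hcons, Matrix.mulVec_mulVec,
      Matrix.mulVec_mulVec, hadd, hX z p hp]
  · rw [dt_mulVec dT df dg, dt_mulVec dT df dg, et, hcons, Matrix.mulVec_mulVec,
      Matrix.mulVec_mulVec, hadd, hTt z p hp]

theorem IntertwinesX.mul (hΩ : IsOpen Ω) {A B : ℂ → ℝ × ℝ → Matrix (Fin 2) (Fin 2) ℂ}
    {q r q' r' q'' r'' : Fld} (hA : ∀ z i j, DifferentiableOn ℝ (fun p => A z p i j) Ω)
    (hB : ∀ z i j, DifferentiableOn ℝ (fun p => B z p i j) Ω)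
    (h1 : IntertwinesX Ω A q' r' q'' r'') (h2 : IntertwinesX Ω B q r q' r') :
    IntertwinesX Ω (fun z p => A z p * B z p) q r q'' r'' := by
  intro z p hp
  have nb := hΩ.mem_nhds hp
  simp only
  rw [dx_mul_matrix (fun i j => (hA z i j).differentiableAt nb)
    fun i j => (hB z i j).differentiableAt nb, ← mul_assoc, ← h1 z p hp, add_mul, mul_assoc,
    mul_assoc, ← h2 z p hp, mul_add, add_assoc]

theorem IntertwinesT.mul (hΩ : IsOpen Ω) {A B : ℂ → ℝ × ℝ → Matrix (Fin 2) (Fin 2) ℂ}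
    {q r q' r' q'' r'' : Fld} (hA : ∀ z i j, DifferentiableOn ℝ (fun p => A z p i j) Ω)
    (hB : ∀ z i j, DifferentiableOn ℝ (fun p => B z p i j) Ω)
    (h1 : IntertwinesT Ω A q' r' q'' r'') (h2 : IntertwinesT Ω B q r q' r') :
    IntertwinesT Ω (fun z p => A z p * B z p) q r q'' r'' := by
  intro z p hp
  have nb := hΩ.mem_nhds hp
  simp only
  rw [dt_mul_matrix (fun i j => (hA z i j).differentiableAt nb)
    fun i j => (hB z i j).differentiableAt nb, ← mul_assoc, ← h1 z p hp, add_mul, mul_assoc,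
    mul_assoc, ← h2 z p hp, mul_add, add_assoc]

/-- Cancelling the invertible `T z p` equates the two `laxU`; their off-diagonal entries are `z` and
`-z` times the potentials. -/
theorem IntertwinesX.unique {T : ℂ → ℝ × ℝ → Matrix (Fin 2) (Fin 2) ℂ}
    {q r q₁ r₁ q₂ r₂ : Fld} (h1 : IntertwinesX Ω T q r q₁ r₁) (h2 : IntertwinesX Ω T q r q₂ r₂)
    {p : ℝ × ℝ} (hp : p ∈ Ω) {z : ℂ} (hz : z ≠ 0) (hT : (T z p).det ≠ 0) :
    q₁ p = q₂ p ∧ r₁ p = r₂ p := by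
  have h3 : laxU q₁ r₁ z p = laxU q₂ r₂ z p :=
    ((Matrix.isUnit_iff_isUnit_det _).2 hT.isUnit).mul_left_injective
      ((h1 z p hp).symm.trans (h2 z p hp))
  have e1 := congrFun (congrFun h3 0) 1
  have e2 := congrFun (congrFun h3 1) 0
  simp only [laxU, matJ, matQ] at e1 e2
  simpa [hz] using And.intro e1 e2

/-- There is a nonzero spectral parameter whose square avoids finitely many given squares. -/
theorem exists_ne_zero_sq_ne (lam : ℕ → ℂ) (n : ℕ) :
    ∃ z : ℂ, z ≠ 0 ∧ ∀ i < n, z ^ 2 ≠ lam i ^ 2 := by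
  obtain ⟨z, hz⟩ := Infinite.exists_notMem_finset
    (insert 0 ((Finset.range n).image lam ∪ (Finset.range n).image fun i => -lam i))
  simp only [Finset.mem_insert, Finset.mem_union, Finset.mem_image, Finset.mem_range,
    not_or, not_exists, not_and] at hz
  refine ⟨z, hz.1, fun i hi h => ?_⟩
  rcases sq_eq_sq_iff_eq_or_eq_neg.1 h with h | h
  · exact hz.2.1 i hi h.symm
  · exact hz.2.2 i hi h.symm

end DNLSII

end

/-! ### Assembly of the theorem -/

theorem corollary1
    (D : DNLSII.DarbouxData) (n : ℕ) (hn : 1 ≤ n)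
    (Ω : Set (ℝ × ℝ)) (hΩ : IsOpen Ω) (hΩc : IsPreconnected Ω)
    (p₀ : ℝ × ℝ) (hp₀ : p₀ ∈ Ω)
    -- the seed, its eigenvalues and its eigenfunctions
    (hseed : DNLSII.IsSolution Ω D.q D.r)
    (hlam : ∀ j < n, D.lam j ≠ 0)
    (hdist : ∀ i < n, ∀ j < n, D.lam i = D.lam j → i = j)
    (heig : ∀ j < n, DNLSII.IsEigenfunction Ω D.q D.r (D.lam j) (D.f j) (D.g j))
    -- the quotients `h` in the steps of the iteration are defined and do not vanish
    (hgen : ∀ k < n, ∀ p ∈ Ω, D.fn k k p ≠ 0 ∧ D.gn k k p ≠ 0)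
    -- the functions `H` of all steps, normalised at one point
    (hH : ∀ k < n, DNLSII.IsExpIntegral Ω (D.qn k) (D.rn k) (D.H k))
    (hnorm : ∀ k, k + 1 < n → D.H (k + 1) p₀ / D.ratio k p₀ = 1)
    -- the square roots in the one-fold matrices
    (hsqrtH : ∀ k < n, DNLSII.IsSqrtBranch Ω (D.H k) (D.sqrtH k))
    (hsqrth : ∀ k < n, DNLSII.IsSqrtBranch Ω (D.ratio k) (D.sqrth k)) :
    -- the new potentials solve the coupled equations
    DNLSII.IsSolution Ω (D.qn n) (D.rn n) ∧
    -- the product matrix is a Darboux matrix from the seed to the new potentials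
    (∀ z i j, DifferentiableOn ℝ (fun p => D.darbouxMatrix n z p i j) Ω) ∧
    DNLSII.IntertwinesX Ω (D.darbouxMatrix n) D.q D.r (D.qn n) (D.rn n) ∧
    DNLSII.IntertwinesT Ω (D.darbouxMatrix n) D.q D.r (D.qn n) (D.rn n) ∧
    -- no other potentials are generated by it
    (∀ q' r' : ℝ × ℝ → ℂ, DNLSII.IntertwinesX Ω (D.darbouxMatrix n) D.q D.r q' r' →
      Set.EqOn q' (D.qn n) Ω ∧ Set.EqOn r' (D.rn n) Ω) ∧
    -- the determinant formulas
    ∀ p ∈ Ω, (D.W n p).det ≠ 0 ∧ (D.What n p).det ≠ 0 ∧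
      (Even n →
        D.qn n p = (D.What n p).det / (D.W n p).det * D.q p
          - 2 * Complex.I * ((D.M n p).det / (D.W n p).det) ∧
        D.rn n p = (D.W n p).det / (D.What n p).det * D.r p
          - 2 * Complex.I * ((D.Mhat n p).det / (D.What n p).det)) ∧
      (Odd n →
        D.qn n p = D.H 0 p * ((D.What n p).det / (D.W n p).det * D.q p
          - 2 * Complex.I * ((D.M n p).det / (D.W n p).det)) ∧
        D.rn n p = 1 / D.H 0 p * ((D.W n p).det / (D.What n p).det * D.r p
          - 2 * Complex.I * ((D.Mhat n p).det / (D.What n p).det))) := by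
  -- All `n` eigenfunctions are carried along, since the one of index `k` must still be an
  -- eigenfunction at level `k` to generate the next step. The last clause stops at `j + 1 < n`, the
  -- range in which `H (j + 1)` is normalised.
  have main : ∀ k ≤ n, DNLSII.IsSolution Ω (D.qn k) (D.rn k) ∧
      (∀ j < n, DNLSII.IsEigenfunction Ω (D.qn k) (D.rn k) (D.lam j) (D.fn k j) (D.gn k j)) ∧
      (∀ z i j, DifferentiableOn ℝ (fun p => D.darbouxMatrix k z p i j) Ω) ∧
      DNLSII.IntertwinesX Ω (D.darbouxMatrix k) D.q D.r (D.qn k) (D.rn k) ∧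
      DNLSII.IntertwinesT Ω (D.darbouxMatrix k) D.q D.r (D.qn k) (D.rn k) ∧
      ∀ j < k, ∀ p ∈ Ω, j + 1 < n → D.H (j + 1) p = D.ratio j p := by
    intro k
    induction k with
    | zero =>
      intro _
      refine ⟨hseed, heig, fun z i j => differentiableOn_const _, fun z p hp => ?_,
        fun z p hp => ?_, fun j hj => by omega⟩
      · ext i j
        simp [DNLSII.DarbouxData.darbouxMatrix, DNLSII.dx]
        rfl
      · ext i j
        simp [DNLSII.DarbouxData.darbouxMatrix, DNLSII.dt]
        rfl
    | succ k ih =>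
      intro hk
      obtain ⟨hs, he, hd, hX, hT, hl⟩ := ih (by omega)
      have S : DNLSII.IsStep Ω (D.qn k) (D.rn k) (D.H k) (D.ratio k) (D.sqrtH k) (D.sqrth k)
          (D.lam k) :=
        ⟨hs, (he k hk).isRiccati hΩ (hgen k hk), hH k hk, hsqrtH k hk, hsqrth k hk⟩
      have hSX := S.intertwinesX hΩ
      have hST := S.intertwinesT hΩ
      refine ⟨S.isSolution hΩ, fun j hj => (he j hj).map hΩ (S.differentiableOn_oneFold _) hSX hST,
        fun z i j => ?_, DNLSII.IntertwinesX.mul hΩ S.differentiableOn_oneFold hd hSX hX,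
        DNLSII.IntertwinesT.mul hΩ S.differentiableOn_oneFold hd hST hT, fun j hj p hp hjn => ?_⟩
      · simp only [DNLSII.DarbouxData.darbouxMatrix, Matrix.mul_apply, Fin.sum_univ_two]
        exact ((S.differentiableOn_oneFold z i 0).mul (hd z 0 j)).add
          ((S.differentiableOn_oneFold z i 1).mul (hd z 1 j))
      · rcases Nat.lt_succ_iff_lt_or_eq.1 hj with h | rfl
        · exact hl j h p hp hjn
        · exact S.next_eq hΩ hΩc (hH (j + 1) hjn) hp₀ (hnorm j hjn) hp
  obtain ⟨hs, -, hd, hX, hT, hl⟩ := main n le_rfl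
  have reg : ∀ p ∈ Ω, D.IsRegularAt n p := fun p hp =>
    ⟨fun k hk => (hgen k hk p hp).1, fun k hk => (hgen k hk p hp).2,
      fun k hk => ((hH k hk).2 p hp).1, fun k hk => (hsqrtH k hk).2 p hp,
      fun k hk => (hsqrth k hk).2 p hp⟩
  refine ⟨hs, hd, hX, hT, fun q' r' h' => ?_, fun p hp => ?_⟩
  -- A single spectral parameter away from `0` and all `±λ_i` serves at every point of `Ω`.
  · obtain ⟨z, hz, hzn⟩ := DNLSII.exists_ne_zero_sq_ne D.lam n
    have key := fun p hp =>
      h'.unique hX hp hz ((reg p hp).det_darbouxMatrix_ne_zero le_rfl hzn)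
    exact ⟨fun p hp => (key p hp).1, fun p hp => (key p hp).2⟩
  · have hlp : ∀ k, k + 1 < n → D.H (k + 1) p = D.ratio k p :=
      fun k hk => hl k (by omega) p hp hk
    obtain ⟨hW, hV, -⟩ := (reg p hp).det_ne_zero_and_eq hlp le_rfl
    have hF := (reg p hp).formulas hn hlp
    refine ⟨hW, hV, fun h => ?_, fun h => ?_⟩
    · simpa [DNLSII.alt, h] using hF
    · simpa [DNLSII.alt, Nat.not_even_iff_odd.2 h] using hF
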